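/- **Conventions.** Manifolds and tensor fields are smooth, and $\sigma=\tfrac12(1+\sqrt5)$, $\bar\sigma=\tfrac12(1-\sqrt5)$. An *almost golden structure* on a manifold $M$ is a $(1,1)$-tensor field $G$ with $G^2=G+I$; its *conjugate* is $\widehat G=I-G$, and $\mathcal E^M_{(\sigma)}=\ker(G-\sigma I)$, $\mathcal E^M_{(\bar\sigma)}=\ker(G-\bar\sigma I)$ are its *eigendistributions*. $(M,h,G)$ is an *almost golden Riemannian manifold* if $h$ is a Riemannian metric with $h(GX,Y)=h(X,GY)$ for all $X,Y$, and an *almost golden-Hermitian manifold* if $h$ is a nondegenerate (semi-Riemannian) metric with $h(GX,Y)=h(X,\widehat GY)$ for all $X,Y$. Throughout, $\nabla$ is the Levi-Civita connection. An almost golden Riemannian manifold is *semi decomposable golden Riemannian* if $\operatorname{div}G=\sum_i h(e_i,e_i)(\nabla_{e_i}G)e_i=0$, where $(e_i)$ is a local orthonormal frame of $TM$. A distribution $D$ on a semi-Riemannian manifold is *Vidal* if $\nabla_XX\in D$ for every smooth section $X$ of $D$. A smooth map $F:(M,G)\to(N,K)$ is *$\pm(G,K)$-golden* if either $F_*\circ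 G=K\circ F_*$ on all of $M$ or $F_*\circ G=\widehat K\circ F_*$ on all of $M$. The second fundamental form of a smooth map $F:(M,h)\to(N,g)$ is $(\nabla F_*)(X,Y)=\nabla^N_{F_*X}(F_*Y)-F_*(\nabla^M_XY)$, where $\nabla^N$ acts on vector fields along $F$. For a distribution $D$ on $M$ (on which $h$ is nondegenerate), the *$D$-tension field* of $F$ is $\mathcal T_D(F)=\sum_{i,j}h^{ij}(\nabla F_*)(e_i,e_j)$, where $(e_i)$ is a local frame of $D$ and $(h^{ij})$ is the inverse of the matrix $(h(e_i,e_j))$; $F$ is *$D$-harmonic* if $\mathcal T_D(F)=0$, and *harmonic* if it is $TM$-harmonic. For $(M,h,G)$ almost golden Riemannian, $F$ is *plus-eigen harmonic* (*minus-eigen harmonic*) if it is $D$-harmonic for $D=\mathcal E^M_{(\sigma)}$ (for $D=\mathcal E^M_{(\bar\sigma)}$). **Theorem.** Let $(M,h,G)$ be a semi decomposable golden Riemannian manifold, and let $(N,g,K)$ be either an almost golden Riemannian manifold or an almost golden-Hermitian manifold such that both eigendistributions $\mathcal E^N_{(\sigma)}$ and $\mathcal E^N_{(\bar\sigma)}$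 of $K$ are Vidal. Let $F:(M,h,G)\to(N,g,K)$ be a $\pm(G,K)$-golden map. Then the following are equivalent: 1. $F$ is harmonic; 2. $F$ is plus-eigen harmonic and minus-eigen harmonic. -/

import Mathlib

open scoped Manifold ContDiff Topology
open Bundle

noncomputable section

namespace GoldenGeometry

/-! Smooth manifolds are modelled on a finite dimensional real vector space `E`, without boundary. -/

section Frames

variable {E : Type*} [NormedAddCommGroup E] [NormedSpace ℝ E]
  {M : Type*} [TopologicalSpace M] [ChartedSpace E M] [IsManifold 𝓘(ℝ, E) ∞ M]

/-- `frameAt x y e` is the tangent vector at `y` with components `e` in the coordinate frame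
(`∂₁, …, ∂ₙ` if `E = ℝⁿ`) of the preferred chart at `x`; meaningful for `y` in that chart. -/
def frameAt (x y : M) : E →L[ℝ] TangentSpace 𝓘(ℝ, E) y :=
  (trivializationAt E (TangentSpace 𝓘(ℝ, E)) x).symmL ℝ y

/-- `coordAt x y v` are the components of `v ∈ T_y M` in the coordinate frame of the preferred
chart at `x`; meaningful for `y` in that chart. -/
def coordAt (x y : M) : TangentSpace 𝓘(ℝ, E) y →L[ℝ] E :=
  (trivializationAt E (TangentSpace 𝓘(ℝ, E)) x).continuousLinearMapAt ℝ y

/-- The extension of `v ∈ T_x M` to a vector field (near `x`) with constant components in the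
preferred chart at `x`. -/
def coordExt (x : M) (v : TangentSpace 𝓘(ℝ, E) x) (y : M) : TangentSpace 𝓘(ℝ, E) y :=
  frameAt x y (coordAt x x v)

end Frames

section Structures

variable (E : Type*) [NormedAddCommGroup E] [NormedSpace ℝ E]
  (M : Type*) [TopologicalSpace M] [ChartedSpace E M] [IsManifold 𝓘(ℝ, E) ∞ M]

/-- A smooth nondegenerate (semi-Riemannian) metric on `M`. -/
structure NondegMetric where
  /-- The bilinear form on each tangent space. -/
  val (x : M) : TangentSpace 𝓘(ℝ, E) x →L[ℝ] TangentSpace 𝓘(ℝ, E) x →L[ℝ] ℝ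
  symm (x : M) (v w : TangentSpace 𝓘(ℝ, E) x) : val x v w = val x w v
  nondegenerate (x : M) (v : TangentSpace 𝓘(ℝ, E) x) (hv : ∀ w, val x v w = 0) : v = 0
  contMDiff : ContMDiff 𝓘(ℝ, E) (𝓘(ℝ, E).prod 𝓘(ℝ, E →L[ℝ] E →L[ℝ] ℝ)) ∞
    (fun x ↦ TotalSpace.mk' (E →L[ℝ] E →L[ℝ] ℝ)
      (E := fun x : M ↦ TangentSpace 𝓘(ℝ, E) x →L[ℝ] TangentSpace 𝓘(ℝ, E) x →L[ℝ] ℝ) x (val x))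

/-- An almost golden structure on `M`: a smooth `(1,1)`-tensor field `G` with `G² = G + I`. -/
structure AlmostGolden where
  /-- The endomorphism of each tangent space. -/
  val (x : M) : TangentSpace 𝓘(ℝ, E) x →L[ℝ] TangentSpace 𝓘(ℝ, E) x
  sq (x : M) (v : TangentSpace 𝓘(ℝ, E) x) : val x (val x v) = val x v + v
  contMDiff : ContMDiff 𝓘(ℝ, E) (𝓘(ℝ, E).prod 𝓘(ℝ, E →L[ℝ] E)) ∞
    (fun x ↦ TotalSpace.mk' (E →L[ℝ] E)
      (E := fun x : M ↦ TangentSpace 𝓘(ℝ, E) x →L[ℝ] TangentSpace 𝓘(ℝ, E) x) x (val x))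

/-- A distribution, given by a subspace of each tangent space. -/
abbrev Distribution := ∀ x : M, Submodule ℝ (TangentSpace 𝓘(ℝ, E) x)

end Structures

section OneManifold

variable {E : Type*} [NormedAddCommGroup E] [NormedSpace ℝ E]
  {M : Type*} [TopologicalSpace M] [ChartedSpace E M] [IsManifold 𝓘(ℝ, E) ∞ M]

/-- The metric is positive definite. -/
def NondegMetric.IsRiemannian (h : NondegMetric E M) : Prop :=
  ∀ (x : M) (v : TangentSpace 𝓘(ℝ, E) x), v ≠ 0 → 0 < h.val x v v

/-- The conjugate structure `Ĝ = I - G`, as an endomorphism of `T_x M`. -/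
def AlmostGolden.conj (G : AlmostGolden E M) (x : M) :
    TangentSpace 𝓘(ℝ, E) x →L[ℝ] TangentSpace 𝓘(ℝ, E) x :=
  ContinuousLinearMap.id ℝ _ - G.val x

/-- `h` is pure with respect to `G`: `h(GX, Y) = h(X, GY)`. -/
def IsPure (h : NondegMetric E M) (G : AlmostGolden E M) : Prop :=
  ∀ (x : M) (v w : TangentSpace 𝓘(ℝ, E) x), h.val x (G.val x v) w = h.val x v (G.val x w)

/-- `h` is hyperbolic with respect to `G`: `h(GX, Y) = h(X, ĜY)`. -/
def IsHyperbolic (h : NondegMetric E M) (G : AlmostGolden E M) : Prop :=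
  ∀ (x : M) (v w : TangentSpace 𝓘(ℝ, E) x), h.val x (G.val x v) w = h.val x v (G.conj x w)

/-- `(M, h, G)` is an almost golden Riemannian manifold. -/
def IsAlmostGoldenRiemannian (h : NondegMetric E M) (G : AlmostGolden E M) : Prop :=
  h.IsRiemannian ∧ IsPure h G

/-- `(M, h, G)` is an almost golden-Hermitian manifold. -/
def IsAlmostGoldenHermitian (h : NondegMetric E M) (G : AlmostGolden E M) : Prop :=
  IsHyperbolic h G

/-- The eigendistribution of `G` for the eigenvalue `k`. -/
def AlmostGolden.eigendistribution (G : AlmostGolden E M) (k : ℝ) : Distribution E M :=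
  fun x ↦ Module.End.eigenspace (G.val x : Module.End ℝ (TangentSpace 𝓘(ℝ, E) x)) k

/-- The matrix `(h_{ij})` of the metric in the coordinates `z` of the preferred chart at `x`, as a
bilinear form on `E`. -/
def NondegMetric.inChart (h : NondegMetric E M) (x : M) (z : E) : E →L[ℝ] E →L[ℝ] ℝ :=
  let y := (extChartAt 𝓘(ℝ, E) x).symm z
  (ContinuousLinearMap.precomp ℝ (frameAt x y)).comp ((h.val y).comp (frameAt x y))

/-- The Christoffel symbols of the Levi-Civita connection at `x` in the preferred chart at `x`, as
a map `E × E → E`: the vector `Γ(a, b)` with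
`h(Γ(a, b), c) = ½ (∂_a h(b, c) + ∂_b h(a, c) - ∂_c h(a, b))` for all `c`. -/
def NondegMetric.christoffel (h : NondegMetric E M) (x : M) (a b : E) : E :=
  let z := extChartAt 𝓘(ℝ, E) x x
  let dh := fderiv ℝ (h.inChart x) z
  (h.inChart x z).inverse ((1 / 2 : ℝ) • (dh a b + dh b a - (dh.flip a).flip b))

/-- `∇_u Y ∈ T_x M` for the Levi-Civita connection `∇` of `h`, a vector field `Y` and `u ∈ T_x M`:
in coordinates, `(∇_u Y)^k = u^i ∂_i Y^k + Γ^k_{ij} u^i Y^j`. -/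
def NondegMetric.covDeriv (h : NondegMetric E M) (Y : ∀ y : M, TangentSpace 𝓘(ℝ, E) y)
    (x : M) (u : TangentSpace 𝓘(ℝ, E) x) : TangentSpace 𝓘(ℝ, E) x :=
  frameAt x x
    (fderiv ℝ (fun z : E ↦
        let y := (extChartAt 𝓘(ℝ, E) x).symm z
        coordAt x y (Y y))
      (extChartAt 𝓘(ℝ, E) x x) (coordAt x x u)
    + h.christoffel x (coordAt x x u) (coordAt x x (Y x)))

/-- `(∇_u A) v = ∇_u (A V) - A (∇_u V)` at `x`, for a `(1,1)`-tensor field `A`; it does not depend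
on the extension `V` of `v`, and the coordinate-constant one is used. -/
def NondegMetric.covDerivEnd (h : NondegMetric E M)
    (A : ∀ y : M, TangentSpace 𝓘(ℝ, E) y →L[ℝ] TangentSpace 𝓘(ℝ, E) y)
    (x : M) (u v : TangentSpace 𝓘(ℝ, E) x) : TangentSpace 𝓘(ℝ, E) x :=
  h.covDeriv (fun y ↦ A y (coordExt x v y)) x u - A x (h.covDeriv (coordExt x v) x u)

/-- The distribution `D` is Vidal: `∇_X X ∈ D` for all smooth sections `X` of `D`. -/
def NondegMetric.IsVidal (h : NondegMetric E M) (D : Distribution E M) : Prop :=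
  ∀ X : ∀ y : M, TangentSpace 𝓘(ℝ, E) y,
    ContMDiff 𝓘(ℝ, E) (𝓘(ℝ, E).prod 𝓘(ℝ, E)) ∞
      (fun y ↦ TotalSpace.mk' E (E := (TangentSpace 𝓘(ℝ, E) : M → Type _)) y (X y)) →
    (∀ y, X y ∈ D y) → ∀ x, h.covDeriv X x (X x) ∈ D x

variable [FiniteDimensional ℝ E]

instance (x : M) : FiniteDimensional ℝ (TangentSpace 𝓘(ℝ, E) x) :=
  inferInstanceAs (FiniteDimensional ℝ E)

/-- The `h`-trace `∑_{i,j} h^{ij} T(e_i, e_j)` over a subspace `D` of `T_x M` of a map `T` (which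
is bilinear in all uses), where `(e_i)` is a basis of `D` and `(h^{ij})` is the inverse of the
matrix `(h(e_i, e_j))`. It does not depend on the basis, and for an `h`-orthonormal basis it is
`∑_i h(e_i, e_i) T(e_i, e_i)`. -/
def NondegMetric.traceOn (h : NondegMetric E M) (x : M)
    (D : Submodule ℝ (TangentSpace 𝓘(ℝ, E) x)) {W : Type*} [AddCommGroup W] [Module ℝ W]
    (T : TangentSpace 𝓘(ℝ, E) x → TangentSpace 𝓘(ℝ, E) x → W) : W :=
  let e := Module.finBasis ℝ D
  let hmat := Matrix.of fun i j ↦ h.val x (e i) (e j)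
  ∑ i, ∑ j, hmat⁻¹ i j • T (e i) (e j)

/-- The divergence `div G = ∑_i h(e_i, e_i) (∇_{e_i} G) e_i` at `x`. -/
def divergence (h : NondegMetric E M) (G : AlmostGolden E M) (x : M) : TangentSpace 𝓘(ℝ, E) x :=
  h.traceOn x ⊤ (h.covDerivEnd G.val x)

/-- `(M, h, G)` is a semi decomposable golden Riemannian manifold. -/
def IsSemiDecomposableGoldenRiemannian (h : NondegMetric E M) (G : AlmostGolden E M) : Prop :=
  IsAlmostGoldenRiemannian h G ∧ ∀ x, divergence h G x = 0

end OneManifold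

section Maps

variable {E : Type*} [NormedAddCommGroup E] [NormedSpace ℝ E]
  {M : Type*} [TopologicalSpace M] [ChartedSpace E M] [IsManifold 𝓘(ℝ, E) ∞ M]
  {E' : Type*} [NormedAddCommGroup E'] [NormedSpace ℝ E']
  {N : Type*} [TopologicalSpace N] [ChartedSpace E' N] [IsManifold 𝓘(ℝ, E') ∞ N]

/-- `F` is `(G, K)`-golden: `F_* ∘ G = K ∘ F_*`. -/
def IsGoldenMap (G : AlmostGolden E M) (K : AlmostGolden E' N) (F : M → N) : Prop :=
  ∀ (x : M) (v : TangentSpace 𝓘(ℝ, E) x),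
    mfderiv 𝓘(ℝ, E) 𝓘(ℝ, E') F x (G.val x v) = K.val (F x) (mfderiv 𝓘(ℝ, E) 𝓘(ℝ, E') F x v)

/-- `F` is `(G, K)`-antigolden: `F_* ∘ G = K̂ ∘ F_*`. -/
def IsAntigoldenMap (G : AlmostGolden E M) (K : AlmostGolden E' N) (F : M → N) : Prop :=
  ∀ (x : M) (v : TangentSpace 𝓘(ℝ, E) x),
    mfderiv 𝓘(ℝ, E) 𝓘(ℝ, E') F x (G.val x v) = K.conj (F x) (mfderiv 𝓘(ℝ, E) 𝓘(ℝ, E') F x v)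

/-- `∇_u V ∈ T_{F x} N` for a vector field `V` along `F : M → N` and `u ∈ T_x M`, with respect to
the connection induced by the Levi-Civita connection of `g`: in coordinates,
`(∇_u V)^c = u^i ∂_i V^c + Γ^c_{ab} (F_* u)^a V^b`. -/
def NondegMetric.covDerivAlong (g : NondegMetric E' N) (F : M → N)
    (V : ∀ y : M, TangentSpace 𝓘(ℝ, E') (F y)) (x : M) (u : TangentSpace 𝓘(ℝ, E) x) :
    TangentSpace 𝓘(ℝ, E') (F x) :=
  frameAt (F x) (F x)
    (fderiv ℝ (fun z : E ↦
        let y := (extChartAt 𝓘(ℝ, E) x).symm z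
        coordAt (F x) (F y) (V y))
      (extChartAt 𝓘(ℝ, E) x x) (coordAt x x u)
    + g.christoffel (F x) (coordAt (F x) (F x) (mfderiv 𝓘(ℝ, E) 𝓘(ℝ, E') F x u))
        (coordAt (F x) (F x) (V x)))

/-- The second fundamental form `(∇F_*)(u, v) = ∇_u (F_* V) - F_* (∇_u V)` at `x`; it does not
depend on the extension `V` of `v`, and the coordinate-constant one is used. -/
def secondFundamentalForm (h : NondegMetric E M) (g : NondegMetric E' N) (F : M → N)
    (x : M) (u v : TangentSpace 𝓘(ℝ, E) x) : TangentSpace 𝓘(ℝ, E') (F x) :=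
  g.covDerivAlong F (fun y ↦ mfderiv 𝓘(ℝ, E) 𝓘(ℝ, E') F y (coordExt x v y)) x u
    - mfderiv 𝓘(ℝ, E) 𝓘(ℝ, E') F x (h.covDeriv (coordExt x v) x u)

variable [FiniteDimensional ℝ E]

/-- The `D`-tension field of `F` at `x`. -/
def tensionField (h : NondegMetric E M) (g : NondegMetric E' N) (D : Distribution E M)
    (F : M → N) (x : M) : TangentSpace 𝓘(ℝ, E') (F x) :=
  h.traceOn x (D x) (secondFundamentalForm h g F x)

/-- `F` is `D`-harmonic: its `D`-tension field vanishes. -/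
def IsHarmonicOn (h : NondegMetric E M) (g : NondegMetric E' N) (D : Distribution E M)
    (F : M → N) : Prop :=
  ∀ x, tensionField h g D F x = 0

/-- `F` is harmonic: its tension field (the case `D = TM`) vanishes. -/
def IsHarmonic (h : NondegMetric E M) (g : NondegMetric E' N) (F : M → N) : Prop :=
  IsHarmonicOn h g (fun _ ↦ ⊤) F

/-- `F` is plus-eigen harmonic: `D`-harmonic for the eigendistribution of `G` for
`σ = (1 + √5) / 2`. -/
def IsPlusEigenHarmonic (h : NondegMetric E M) (G : AlmostGolden E M) (g : NondegMetric E' N)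
    (F : M → N) : Prop :=
  IsHarmonicOn h g (G.eigendistribution Real.goldenRatio) F

/-- `F` is minus-eigen harmonic: `D`-harmonic for the eigendistribution of `G` for
`σ̄ = (1 - √5) / 2`. -/
def IsMinusEigenHarmonic (h : NondegMetric E M) (G : AlmostGolden E M) (g : NondegMetric E' N)
    (F : M → N) : Prop :=
  IsHarmonicOn h g (G.eigendistribution Real.goldenConj) F

end Maps

end GoldenGeometry

end

noncomputable section

namespace GoldenGeometry

/-! ### Tensor fields in the preferred chart at a point -/

section Charts

variable {E : Type*} [NormedAddCommGroup E] [NormedSpace ℝ E]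
  {M : Type*} [TopologicalSpace M] [ChartedSpace E M] [IsManifold 𝓘(ℝ, E) ∞ M]

/-! Let `τ`, `τ₊`, `τ₋` be the tension fields of `F` over `TM` and over the two eigendistributions
of `G`. Purity makes the eigendistributions orthogonal, and `G² = G + I` makes them span, so `τ = τ₊
+ τ₋` (`tensionField_top_eq_add`). This gives one implication at once.

For the other, write both the golden and the antigolden condition as `F_* G = r F_* + s K F_*`.
Differentiating yields, for `B = ∇F_*`, the identity `B(u, Gv) = r B(u, v) + s K B(u, v) + s (∇_{F_*
u} K) F_* v - F_* ((∇_u G) v)` (`secondFundamentalForm_golden`). Now take the `h`-trace. The left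
side becomes `σ τ₊ + σ̄ τ₋`, and the last term is `F_* (div G) = 0`. The `∇K` term is traced
separately over each eigendistribution of `G`: `F_*` carries its vectors to eigenvectors `w` of `K`,
and Vidality gives `(∇_w K) w = 0` (`covDerivEnd_self_of_isVidal`). The pulled-back form is
therefore alternating there, and its trace against the symmetric `h^{ij}` vanishes.

Hence `σ τ₊ + σ̄ τ₋ = r τ + s K τ` (`smul_tensionField_add_smul_tensionField`). If `τ = 0`, then `τ₊
+ τ₋ = 0` and `σ τ₊ + σ̄ τ₋ = 0`, a linear system with invertible matrix since `σ - σ̄ = √5 ≠ 0`. -/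

theorem frameAt_self (x : M) : frameAt x x = ContinuousLinearMap.id ℝ E := by
  ext e
  have hx : x ∈ (chartAt E x).source := mem_chart_source E x
  unfold frameAt
  rw [TangentBundle.symmL_trivializationAt_eq_core hx]
  exact (tangentBundleCore 𝓘(ℝ, E) M).coordChange_self _ _ hx _

theorem coordAt_self (x : M) : coordAt x x = ContinuousLinearMap.id ℝ E := by
  ext e
  have hx : x ∈ (chartAt E x).source := mem_chart_source E x
  unfold coordAt
  rw [TangentBundle.continuousLinearMapAt_trivializationAt_eq_core hx]
  exact (tangentBundleCore 𝓘(ℝ, E) M).coordChange_self _ _ hx _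

theorem coordAt_frameAt {x y : M} (hy : y ∈ (chartAt E x).source) (e : E) :
    coordAt x y (frameAt x y e) = e :=
  (trivializationAt E (TangentSpace 𝓘(ℝ, E)) x).continuousLinearMapAt_symmL (R := ℝ) hy e

theorem frameAt_coordAt {x y : M} (hy : y ∈ (chartAt E x).source) (v : TangentSpace 𝓘(ℝ, E) y) :
    frameAt x y (coordAt x y v) = v :=
  (trivializationAt E (TangentSpace 𝓘(ℝ, E)) x).symmL_continuousLinearMapAt (R := ℝ) hy v

omit [IsManifold 𝓘(ℝ, E) ∞ M] in
theorem eventually_symm_mem_source (x : M) : ∀ᶠ z in 𝓝 (extChartAt 𝓘(ℝ, E) x x),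
    (extChartAt 𝓘(ℝ, E) x).symm z ∈ (chartAt E x).source := by
  have := extChartAt_target_mem_nhds (I := 𝓘(ℝ, E)) x
  filter_upwards [this] with z hz
  simpa only [extChartAt_source] using (extChartAt 𝓘(ℝ, E) x).map_target hz

omit [IsManifold 𝓘(ℝ, E) ∞ M] in
/-- A smooth function on `M` is smooth in the coordinates of a chart. -/
theorem _root_.ContMDiffAt.contDiffAt_inChart {W : Type*} [NormedAddCommGroup W] [NormedSpace ℝ W]
    {f : M → W} {x : M} (hf : ContMDiffAt 𝓘(ℝ, E) 𝓘(ℝ, W) ∞ f x) :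
    ContDiffAt ℝ ∞ (fun z ↦ f ((extChartAt 𝓘(ℝ, E) x).symm z)) (extChartAt 𝓘(ℝ, E) x x) := by
  have := (contMDiffAt_iff.1 hf).2
  rw [modelWithCornersSelf_coe, Set.range_id, contDiffWithinAt_univ] at this
  exact this

/-- The coordinate expression of a field of endomorphisms in the preferred chart at `x`. -/
def endInChart (A : ∀ y : M, TangentSpace 𝓘(ℝ, E) y →L[ℝ] TangentSpace 𝓘(ℝ, E) y) (x : M)
    (z : E) : E →L[ℝ] E :=
  let y := (extChartAt 𝓘(ℝ, E) x).symm z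
  (coordAt x y).comp ((A y).comp (frameAt x y))

theorem AlmostGolden.contDiffAt_inChart (G : AlmostGolden E M) (x : M) :
    ContDiffAt ℝ ∞ (endInChart G.val x) (extChartAt 𝓘(ℝ, E) x x) :=
  ((contMDiffAt_hom_bundle _).1 (G.contMDiff x)).2.contDiffAt_inChart

/-- The coordinate expression of a vector field in the preferred chart at `x`. -/
def fieldInChart (X : ∀ y : M, TangentSpace 𝓘(ℝ, E) y) (x : M) (z : E) : E :=
  coordAt x ((extChartAt 𝓘(ℝ, E) x).symm z) (X ((extChartAt 𝓘(ℝ, E) x).symm z))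

/-- Smoothness of a section concerns the trivialization itself, which agrees with `coordAt` only
over the chart domain; hence the detour through eventual equality. -/
theorem contDiffAt_fieldInChart {X : ∀ y : M, TangentSpace 𝓘(ℝ, E) y} {x : M}
    (hX : ContMDiffAt 𝓘(ℝ, E) (𝓘(ℝ, E).prod 𝓘(ℝ, E)) ∞
      (fun y ↦ TotalSpace.mk' E (E := (TangentSpace 𝓘(ℝ, E) : M → Type _)) y (X y)) x) :
    ContDiffAt ℝ ∞ (fieldInChart X x) (extChartAt 𝓘(ℝ, E) x x) := by
  refine ((contMDiffAt_totalSpace.1 hX).2.contDiffAt_inChart).congr_of_eventuallyEq ?_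
  filter_upwards [eventually_symm_mem_source x] with z hz
  unfold fieldInChart coordAt
  rw [Trivialization.continuousLinearMapAt_apply]
  exact congrFun (Trivialization.coe_linearMapAt_of_mem (R := ℝ) _ hz) _

end Charts

/-! ### Christoffel symbols and covariant derivatives as coordinate formulas -/

section Christoffel

variable {E : Type*} [NormedAddCommGroup E] [NormedSpace ℝ E]
  {M : Type*} [TopologicalSpace M] [ChartedSpace E M] [IsManifold 𝓘(ℝ, E) ∞ M]

theorem fderiv_clm_apply_const {W : Type*} [NormedAddCommGroup W] [NormedSpace ℝ W]
    {c : E → E →L[ℝ] W} {z : E} (hc : DifferentiableAt ℝ c z) (u v : E) :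
    fderiv ℝ (fun z ↦ c z v) z u = fderiv ℝ c z u v := by
  rw [fderiv_clm_apply hc (differentiableAt_const _)]
  simp

theorem endInChart_extChartAt
    (A : ∀ y : M, TangentSpace 𝓘(ℝ, E) y →L[ℝ] TangentSpace 𝓘(ℝ, E) y) {x y : M}
    (hy : y ∈ (chartAt E x).source) :
    endInChart A x (extChartAt 𝓘(ℝ, E) x y) =
      (coordAt x y).comp ((A y).comp (frameAt x y)) := by
  rw [← extChartAt_source 𝓘(ℝ, E)] at hy
  simp only [endInChart]
  rw [(extChartAt 𝓘(ℝ, E) x).left_inv hy]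

theorem endInChart_self
    (A : ∀ y : M, TangentSpace 𝓘(ℝ, E) y →L[ℝ] TangentSpace 𝓘(ℝ, E) y) (x : M) :
    endInChart A x (extChartAt 𝓘(ℝ, E) x x) = A x := by
  rw [endInChart_extChartAt A (mem_chart_source E x), coordAt_self, frameAt_self]
  rfl

theorem fieldInChart_self (X : ∀ y : M, TangentSpace 𝓘(ℝ, E) y) (x : M) :
    fieldInChart X x (extChartAt 𝓘(ℝ, E) x x) = X x := by
  simp only [fieldInChart]
  rw [extChartAt_to_inv, coordAt_self]
  rfl

/-- The functional `c ↦ ½ (B(a, b, c) + B(b, a, c) - B(c, a, b))`. -/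
def koszul (B : E →L[ℝ] E →L[ℝ] E →L[ℝ] ℝ) (a b : E) : E →L[ℝ] ℝ :=
  (1 / 2 : ℝ) • (B a b + B b a - (B.flip a).flip b)

theorem koszul_apply (B : E →L[ℝ] E →L[ℝ] E →L[ℝ] ℝ) (a b c : E) :
    koszul B a b c = 1 / 2 * (B a b c + B b a c - B c a b) :=
  rfl

theorem koszul_add_left (B : E →L[ℝ] E →L[ℝ] E →L[ℝ] ℝ) (a a' b : E) :
    koszul B (a + a') b = koszul B a b + koszul B a' b := by
  refine ContinuousLinearMap.ext fun c ↦ ?_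
  have h1 : B (a + a') b c = B a b c + B a' b c := by rw [B.map_add]; rfl
  have h2 : B b (a + a') c = B b a c + B b a' c := by rw [(B b).map_add]; rfl
  have h3 : B c (a + a') b = B c a b + B c a' b := by rw [(B c).map_add]; rfl
  change koszul B (a + a') b c = koszul B a b c + koszul B a' b c
  rw [koszul_apply, koszul_apply, koszul_apply, h1, h2, h3]
  ring

theorem koszul_smul_left (B : E →L[ℝ] E →L[ℝ] E →L[ℝ] ℝ) (r : ℝ) (a b : E) :
    koszul B (r • a) b = r • koszul B a b := by
  refine ContinuousLinearMap.ext fun c ↦ ?_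
  have h1 : B (r • a) b c = r * B a b c := by rw [B.map_smul]; rfl
  have h2 : B b (r • a) c = r * B b a c := by rw [(B b).map_smul]; rfl
  have h3 : B c (r • a) b = r * B c a b := by rw [(B c).map_smul]; rfl
  change koszul B (r • a) b c = r * koszul B a b c
  rw [koszul_apply, koszul_apply, h1, h2, h3]
  ring

theorem koszul_add_right (B : E →L[ℝ] E →L[ℝ] E →L[ℝ] ℝ) (a b b' : E) :
    koszul B a (b + b') = koszul B a b + koszul B a b' := by
  refine ContinuousLinearMap.ext fun c ↦ ?_
  have h1 : B a (b + b') c = B a b c + B a b' c := by rw [(B a).map_add]; rfl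
  have h2 : B (b + b') a c = B b a c + B b' a c := by rw [B.map_add]; rfl
  have h3 : B c a (b + b') = B c a b + B c a b' := by rw [(B c a).map_add]
  change koszul B a (b + b') c = koszul B a b c + koszul B a b' c
  rw [koszul_apply, koszul_apply, koszul_apply, h1, h2, h3]
  ring

theorem koszul_smul_right (B : E →L[ℝ] E →L[ℝ] E →L[ℝ] ℝ) (r : ℝ) (a b : E) :
    koszul B a (r • b) = r • koszul B a b := by
  refine ContinuousLinearMap.ext fun c ↦ ?_
  have h1 : B a (r • b) c = r * B a b c := by rw [(B a).map_smul]; rfl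
  have h2 : B (r • b) a c = r * B b a c := by rw [B.map_smul]; rfl
  have h3 : B c a (r • b) = r * B c a b := by rw [(B c a).map_smul]; rfl
  change koszul B a (r • b) c = r * koszul B a b c
  rw [koszul_apply, koszul_apply, h1, h2, h3]
  ring

/-- The Christoffel symbols as a bilinear map. -/
def NondegMetric.christoffelₗ (h : NondegMetric E M) (x : M) : E →ₗ[ℝ] E →ₗ[ℝ] E :=
  let I := (h.inChart x (extChartAt 𝓘(ℝ, E) x x)).inverse
  let B := fderiv ℝ (h.inChart x) (extChartAt 𝓘(ℝ, E) x x)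
  LinearMap.mk₂ ℝ (fun a b ↦ I (koszul B a b))
    (fun a a' b ↦ by rw [koszul_add_left, I.map_add])
    (fun r a b ↦ by rw [koszul_smul_left, I.map_smul])
    (fun a b b' ↦ by rw [koszul_add_right, I.map_add])
    (fun r a b ↦ by rw [koszul_smul_right, I.map_smul])

/-- At the centre of the chart `T_x M` is `E` itself and the frames are the identity, so they
disappear. Of the Christoffel symbols only bilinearity is used from here on. -/
theorem NondegMetric.covDeriv_eq (h : NondegMetric E M) (Y : ∀ y : M, TangentSpace 𝓘(ℝ, E) y)
    (x : M) (u : TangentSpace 𝓘(ℝ, E) x) :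
    h.covDeriv Y x u = (fderiv ℝ (fieldInChart Y x) (extChartAt 𝓘(ℝ, E) x x) u
      + h.christoffelₗ x u (Y x) : E) := by
  unfold covDeriv
  rw [frameAt_self, coordAt_self]
  rfl

theorem coordExt_self (x : M) (v : TangentSpace 𝓘(ℝ, E) x) : coordExt x v x = v :=
  frameAt_coordAt (mem_chart_source E x) v

/-- The components of the extension are constant, so only the Christoffel term survives. -/
theorem NondegMetric.covDeriv_coordExt (h : NondegMetric E M) (x : M)
    (u v : TangentSpace 𝓘(ℝ, E) x) :
    h.covDeriv (coordExt x v) x u = h.christoffelₗ x u v := by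
  rw [covDeriv_eq, coordExt_self]
  have : fieldInChart (coordExt x v) x =ᶠ[𝓝 (extChartAt 𝓘(ℝ, E) x x)] fun _ ↦ coordAt x x v := by
    filter_upwards [eventually_symm_mem_source x] with z hz
    exact coordAt_frameAt hz _
  rw [this.fderiv_eq, fderiv_fun_const]
  exact zero_add _

theorem NondegMetric.covDerivEnd_eq (h : NondegMetric E M) (G : AlmostGolden E M) (x : M)
    (u v : TangentSpace 𝓘(ℝ, E) x) :
    h.covDerivEnd G.val x u v = (fderiv ℝ (endInChart G.val x) (extChartAt 𝓘(ℝ, E) x x) u v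
      + h.christoffelₗ x u (endInChart G.val x (extChartAt 𝓘(ℝ, E) x x) v)
      - endInChart G.val x (extChartAt 𝓘(ℝ, E) x x) (h.christoffelₗ x u v) : E) := by
  unfold covDerivEnd
  rw [endInChart_self, covDeriv_coordExt, covDeriv_eq, coordExt_self]
  have hf : fieldInChart (fun y ↦ G.val y (coordExt x v y)) x =
      fun z ↦ endInChart G.val x z v := by
    funext z
    simp only [fieldInChart, endInChart, coordExt, coordAt_self]
    rfl
  have hd : DifferentiableAt ℝ (endInChart G.val x) (extChartAt 𝓘(ℝ, E) x x) :=
    (G.contDiffAt_inChart x).differentiableAt (by simp)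
  have key : fderiv ℝ (fun z ↦ endInChart G.val x z v) (extChartAt 𝓘(ℝ, E) x x) u =
      fderiv ℝ (endInChart G.val x) (extChartAt 𝓘(ℝ, E) x x) u v := fderiv_clm_apply_const hd u v
  rw [hf, key]
  rfl

end Christoffel
-- The second fundamental form in coordinates
section MapCoordinates

variable {E : Type*} [NormedAddCommGroup E] [NormedSpace ℝ E]
  {M : Type*} [TopologicalSpace M] [ChartedSpace E M] [IsManifold 𝓘(ℝ, E) ∞ M]
  {E' : Type*} [NormedAddCommGroup E'] [NormedSpace ℝ E']
  {N : Type*} [TopologicalSpace N] [ChartedSpace E' N] [IsManifold 𝓘(ℝ, E') ∞ N]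

variable (E E') in
/-- The coordinate expression of `F` in the preferred charts at `x` and `F x`. -/
def mapInChart (F : M → N) (x : M) (z : E) : E' :=
  extChartAt 𝓘(ℝ, E') (F x) (F ((extChartAt 𝓘(ℝ, E) x).symm z))

omit [IsManifold 𝓘(ℝ, E) ∞ M] [IsManifold 𝓘(ℝ, E') ∞ N] in
theorem contDiffAt_mapInChart {F : M → N} (hF : ContMDiff 𝓘(ℝ, E) 𝓘(ℝ, E') ∞ F) (x : M) :
    ContDiffAt ℝ ∞ (mapInChart E E' F x) (extChartAt 𝓘(ℝ, E) x x) := by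
  have := (contMDiffAt_iff.1 (hF x)).2
  rw [modelWithCornersSelf_coe, Set.range_id, contDiffWithinAt_univ] at this
  exact this

omit [IsManifold 𝓘(ℝ, E) ∞ M] [IsManifold 𝓘(ℝ, E') ∞ N] [NormedSpace ℝ E'] in
theorem eventually_map_symm_mem_source {F : M → N} (hF : Continuous F) (x : M) :
    ∀ᶠ z in 𝓝 (extChartAt 𝓘(ℝ, E) x x),
      F ((extChartAt 𝓘(ℝ, E) x).symm z) ∈ (chartAt E' (F x)).source := by
  have h1 := (hF.continuousAt (x := x)).preimage_mem_nhds (chart_source_mem_nhds E' (F x))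
  have h2 := continuousAt_extChartAt_symm (I := 𝓘(ℝ, E)) x
  rw [ContinuousAt, extChartAt_to_inv] at h2
  exact h2 h1

/-- Chain rule: over the chart domains `coordAt` is the derivative of the chart and `frameAt` that
of its inverse. It is needed on a neighbourhood because `∇F_*` differentiates it once more. -/
theorem fderiv_mapInChart {F : M → N} (hF : ContMDiff 𝓘(ℝ, E) 𝓘(ℝ, E') ∞ F) (x : M) :
    ∀ᶠ z in 𝓝 (extChartAt 𝓘(ℝ, E) x x),
      fderiv ℝ (mapInChart E E' F x) z =
        (coordAt (F x) (F ((extChartAt 𝓘(ℝ, E) x).symm z))).comp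
          ((mfderiv 𝓘(ℝ, E) 𝓘(ℝ, E') F ((extChartAt 𝓘(ℝ, E) x).symm z)).comp
            (frameAt x ((extChartAt 𝓘(ℝ, E) x).symm z))) := by
  filter_upwards [eventually_symm_mem_source x, eventually_map_symm_mem_source (E' := E') hF.continuous x,
    extChartAt_target_mem_nhds (I := 𝓘(ℝ, E)) x] with z h1 h2 h3
  have e1 := TangentBundle.continuousLinearMapAt_trivializationAt (I := 𝓘(ℝ, E')) h2
  have e2 := TangentBundle.symmL_trivializationAt (I := 𝓘(ℝ, E)) h1
  rw [modelWithCornersSelf_coe, Set.range_id, mfderivWithin_univ,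
    (extChartAt 𝓘(ℝ, E) x).right_inv h3] at e2
  have d1 : MDifferentiableAt 𝓘(ℝ, E') 𝓘(ℝ, E') (extChartAt 𝓘(ℝ, E') (F x))
      (F ((extChartAt 𝓘(ℝ, E) x).symm z)) := mdifferentiableAt_extChartAt (I := 𝓘(ℝ, E')) h2
  have d2 : MDifferentiableWithinAt 𝓘(ℝ, E) 𝓘(ℝ, E) (extChartAt 𝓘(ℝ, E) x).symm
      (Set.range 𝓘(ℝ, E)) z := mdifferentiableWithinAt_extChartAt_symm (I := 𝓘(ℝ, E)) h3
  rw [modelWithCornersSelf_coe, Set.range_id, mdifferentiableWithinAt_univ] at d2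
  have d3 : MDifferentiableAt 𝓘(ℝ, E) 𝓘(ℝ, E') F ((extChartAt 𝓘(ℝ, E) x).symm z) :=
    hF.mdifferentiableAt (by simp)
  rw [← mfderiv_eq_fderiv]
  have c1 : mfderiv 𝓘(ℝ, E) 𝓘(ℝ, E') (fun z ↦ F ((extChartAt 𝓘(ℝ, E) x).symm z)) z = _ :=
    mfderiv_comp z d3 d2
  have c2 : mfderiv 𝓘(ℝ, E) 𝓘(ℝ, E') (mapInChart E E' F x) z = _ :=
    mfderiv_comp (I' := 𝓘(ℝ, E')) (g := extChartAt 𝓘(ℝ, E') (F x)) z d1 (d3.comp z d2)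
  rw [c2, c1]
  unfold coordAt frameAt
  rw [e1, e2]
  rfl

theorem fderiv_mapInChart_self {F : M → N} (hF : ContMDiff 𝓘(ℝ, E) 𝓘(ℝ, E') ∞ F) (x : M) :
    fderiv ℝ (mapInChart E E' F x) (extChartAt 𝓘(ℝ, E) x x) = mfderiv 𝓘(ℝ, E) 𝓘(ℝ, E') F x := by
  rw [(fderiv_mapInChart hF x).self_of_nhds, extChartAt_to_inv, coordAt_self, frameAt_self]
  rfl

omit [IsManifold 𝓘(ℝ, E) ∞ M] [IsManifold 𝓘(ℝ, E') ∞ N] in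
theorem mapInChart_self (F : M → N) (x : M) :
    mapInChart E E' F x (extChartAt 𝓘(ℝ, E) x x) = extChartAt 𝓘(ℝ, E') (F x) (F x) := by
  rw [mapInChart, extChartAt_to_inv]

theorem secondFundamentalForm_eq (h : NondegMetric E M) (g : NondegMetric E' N) {F : M → N}
    (hF : ContMDiff 𝓘(ℝ, E) 𝓘(ℝ, E') ∞ F) (x : M) (u v : TangentSpace 𝓘(ℝ, E) x) :
    secondFundamentalForm h g F x u v =
      (fderiv ℝ (fderiv ℝ (mapInChart E E' F x)) (extChartAt 𝓘(ℝ, E) x x) u v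
        + g.christoffelₗ (F x) 
            (fderiv ℝ (mapInChart E E' F x) (extChartAt 𝓘(ℝ, E) x x) u)
            (fderiv ℝ (mapInChart E E' F x) (extChartAt 𝓘(ℝ, E) x x) v)
        - fderiv ℝ (mapInChart E E' F x) (extChartAt 𝓘(ℝ, E) x x) (h.christoffelₗ x u v) : E') := by
  unfold secondFundamentalForm NondegMetric.covDerivAlong
  rw [h.covDeriv_coordExt, fderiv_mapInChart_self hF, frameAt_self, coordAt_self, coordAt_self]
  have key : (fun z : E ↦
        let y := (extChartAt 𝓘(ℝ, E) x).symm z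
        coordAt (F x) (F y) (mfderiv 𝓘(ℝ, E) 𝓘(ℝ, E') F y (coordExt x v y)))
      =ᶠ[𝓝 (extChartAt 𝓘(ℝ, E) x x)] fun z ↦ fderiv ℝ (mapInChart E E' F x) z v := by
    filter_upwards [fderiv_mapInChart hF x] with z hz
    rw [hz]
    simp only [coordExt, coordAt_self]
    rfl
  have hd : DifferentiableAt ℝ (fderiv ℝ (mapInChart E E' F x)) (extChartAt 𝓘(ℝ, E) x x) :=
    ((contDiffAt_mapInChart hF x).fderiv_right (m := ∞) le_rfl).differentiableAt (by simp)
  have key2 : fderiv ℝ (fun z ↦ fderiv ℝ (mapInChart E E' F x) z v)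
      (extChartAt 𝓘(ℝ, E) x x) u = _ := fderiv_clm_apply_const hd u v
  have key3 := key.fderiv_eq (𝕜 := ℝ)
  refine congrArg₂ (· - ·) (congrArg₂ (· + ·) ((DFunLike.congr_fun key3 _).trans key2)
    (congrArg _ (congrArg _ (coordExt_self x v)))) rfl

end MapCoordinates

/-! ### Differentiating the golden relation -/

section GoldenMaps

variable {E : Type*} [NormedAddCommGroup E] [NormedSpace ℝ E]
  {M : Type*} [TopologicalSpace M] [ChartedSpace E M] [IsManifold 𝓘(ℝ, E) ∞ M]
  {E' : Type*} [NormedAddCommGroup E'] [NormedSpace ℝ E']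
  {N : Type*} [TopologicalSpace N] [ChartedSpace E' N] [IsManifold 𝓘(ℝ, E') ∞ N]

/-- The relation `F_* ∘ G = r F_* + s K ∘ F_*` in coordinates. -/
theorem fderiv_mapInChart_comp_endInChart (G : AlmostGolden E M) (K : AlmostGolden E' N)
    {F : M → N} (hF : ContMDiff 𝓘(ℝ, E) 𝓘(ℝ, E') ∞ F) {r s : ℝ}
    (hGK : ∀ (x : M) (v : TangentSpace 𝓘(ℝ, E) x), mfderiv 𝓘(ℝ, E) 𝓘(ℝ, E') F x (G.val x v) =
      r • mfderiv 𝓘(ℝ, E) 𝓘(ℝ, E') F x v + s • K.val (F x) (mfderiv 𝓘(ℝ, E) 𝓘(ℝ, E') F x v))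
    (x : M) (v : E) :
    ∀ᶠ z in 𝓝 (extChartAt 𝓘(ℝ, E) x x),
      fderiv ℝ (mapInChart E E' F x) z (endInChart G.val x z v) =
        r • fderiv ℝ (mapInChart E E' F x) z v +
        s • endInChart K.val (F x) (mapInChart E E' F x z)
          (fderiv ℝ (mapInChart E E' F x) z v) := by
  filter_upwards [eventually_symm_mem_source x,
    eventually_map_symm_mem_source (E' := E') hF.continuous x, fderiv_mapInChart hF x]
    with z h1 h2 h3
  rw [h3, mapInChart, endInChart_extChartAt K.val h2]
  set y := (extChartAt 𝓘(ℝ, E) x).symm z with hy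
  change coordAt (F x) (F y) (mfderiv 𝓘(ℝ, E) 𝓘(ℝ, E') F y (frameAt x y (coordAt x y
      (G.val y (frameAt x y v))))) =
    r • coordAt (F x) (F y) (mfderiv 𝓘(ℝ, E) 𝓘(ℝ, E') F y (frameAt x y v)) +
    s • coordAt (F x) (F y) (K.val (F y) (frameAt (F x) (F y) (coordAt (F x) (F y)
      (mfderiv 𝓘(ℝ, E) 𝓘(ℝ, E') F y (frameAt x y v)))))
  rw [frameAt_coordAt h1, frameAt_coordAt h2, hGK, map_add, map_smul, map_smul]

/-- The derivative of the relation `Df ∘ γ = r Df + s (κ ∘ f) Df`. -/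
theorem fderiv_fderiv_apply_of_intertwining {f : E → E'} {γ : E → E →L[ℝ] E}
    {κ : E' → E' →L[ℝ] E'} {z : E} {r s : ℝ} (hf : DifferentiableAt ℝ f z)
    (hdf : DifferentiableAt ℝ (fderiv ℝ f) z) (hγ : DifferentiableAt ℝ γ z)
    (hκ : DifferentiableAt ℝ κ (f z))
    (hev : ∀ v, ∀ᶠ z in 𝓝 z,
      fderiv ℝ f z (γ z v) = r • fderiv ℝ f z v + s • κ (f z) (fderiv ℝ f z v)) (u v : E) :
    fderiv ℝ (fderiv ℝ f) z u (γ z v) = r • fderiv ℝ (fderiv ℝ f) z u v +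
      s • (κ (f z) (fderiv ℝ (fderiv ℝ f) z u v) +
        fderiv ℝ κ (f z) (fderiv ℝ f z u) (fderiv ℝ f z v)) - fderiv ℝ f z (fderiv ℝ γ z u v) := by
  have hdfv : DifferentiableAt ℝ (fun z ↦ fderiv ℝ f z v) z :=
    hdf.clm_apply (differentiableAt_const _)
  have hγv : DifferentiableAt ℝ (fun z ↦ γ z v) z := hγ.clm_apply (differentiableAt_const _)
  have hκf : DifferentiableAt ℝ (fun z ↦ κ (f z)) z := hκ.comp z hf
  have hκv : DifferentiableAt ℝ (fun z ↦ κ (f z) (fderiv ℝ f z v)) z := hκf.clm_apply hdfv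
  have key : fderiv ℝ (fun z ↦ fderiv ℝ f z (γ z v)) z u =
      fderiv ℝ (fun z ↦ r • fderiv ℝ f z v + s • κ (f z) (fderiv ℝ f z v)) z u := by
    rw [(show _ =ᶠ[𝓝 z] _ from hev v).fderiv_eq]
  have e1 : fderiv ℝ (fun z ↦ fderiv ℝ f z (γ z v)) z u =
      fderiv ℝ f z (fderiv ℝ γ z u v) + fderiv ℝ (fderiv ℝ f) z u (γ z v) := by
    rw [fderiv_clm_apply hdf hγv, ← fderiv_clm_apply_const hγ u v]
    rfl
  have e2 : fderiv ℝ (fun z ↦ κ (f z)) z u = fderiv ℝ κ (f z) (fderiv ℝ f z u) :=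
    DFunLike.congr_fun (fderiv_comp z hκ hf) u
  have e3 : fderiv ℝ (fun z ↦ κ (f z) (fderiv ℝ f z v)) z u =
      κ (f z) (fderiv ℝ (fderiv ℝ f) z u v) +
        fderiv ℝ κ (f z) (fderiv ℝ f z u) (fderiv ℝ f z v) := by
    rw [fderiv_clm_apply hκf hdfv, ← fderiv_clm_apply_const hdf u v, ← e2]
    rfl
  have e4 : fderiv ℝ (fun z ↦ r • fderiv ℝ f z v + s • κ (f z) (fderiv ℝ f z v)) z u =
      r • fderiv ℝ (fderiv ℝ f) z u v + s • fderiv ℝ (fun z ↦ κ (f z) (fderiv ℝ f z v)) z u := by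
    rw [fderiv_fun_add (hdfv.fun_const_smul r) (hκv.fun_const_smul s), fderiv_fun_const_smul hdfv,
      fderiv_fun_const_smul hκv, ← fderiv_clm_apply_const hdf u v]
    rfl
  rw [e1, e4, e3] at key
  rw [← key]
  abel

/-- The second fundamental form and the covariant derivatives of the structures. -/
theorem secondFundamentalForm_golden (h : NondegMetric E M) (g : NondegMetric E' N)
    (G : AlmostGolden E M) (K : AlmostGolden E' N)
    {F : M → N} (hF : ContMDiff 𝓘(ℝ, E) 𝓘(ℝ, E') ∞ F) {r s : ℝ}
    (hGK : ∀ (x : M) (v : TangentSpace 𝓘(ℝ, E) x), mfderiv 𝓘(ℝ, E) 𝓘(ℝ, E') F x (G.val x v) =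
      r • mfderiv 𝓘(ℝ, E) 𝓘(ℝ, E') F x v + s • K.val (F x) (mfderiv 𝓘(ℝ, E) 𝓘(ℝ, E') F x v))
    (x : M) (u v : TangentSpace 𝓘(ℝ, E) x) :
    secondFundamentalForm h g F x u (G.val x v) =
      r • secondFundamentalForm h g F x u v
        + s • K.val (F x) (secondFundamentalForm h g F x u v)
        + s • g.covDerivEnd K.val (F x) (mfderiv 𝓘(ℝ, E) 𝓘(ℝ, E') F x u)
            (mfderiv 𝓘(ℝ, E) 𝓘(ℝ, E') F x v)
        - mfderiv 𝓘(ℝ, E) 𝓘(ℝ, E') F x (h.covDerivEnd G.val x u v) := by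
  rw [secondFundamentalForm_eq h g hF, secondFundamentalForm_eq h g hF,
    NondegMetric.covDerivEnd_eq, NondegMetric.covDerivEnd_eq, ← fderiv_mapInChart_self hF,
    ← endInChart_self G.val x, ← endInChart_self K.val (F x)]
  have hev := fderiv_mapInChart_comp_endInChart G K hF hGK x
  have hf := contDiffAt_mapInChart hF x
  have hG := (G.contDiffAt_inChart x).differentiableAt (by simp)
  have hK := (K.contDiffAt_inChart (F x)).differentiableAt (by simp)
  rw [← mapInChart_self (E := E) F x] at hK ⊢
  have e5 := fderiv_fderiv_apply_of_intertwining (hf.differentiableAt (by simp))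
    ((hf.fderiv_right (m := ∞) le_rfl).differentiableAt (by simp)) hG hK hev u v
  have e0 : ∀ w : E, _ := fun w ↦ (hev w).self_of_nhds
  set z := extChartAt 𝓘(ℝ, E) x x
  set f := mapInChart E E' F x
  set γ := endInChart G.val x
  set κ := endInChart K.val (F x)
  set Γ := h.christoffelₗ x
  set Γ' := g.christoffelₗ (F x)
  -- The undifferentiated relation enters twice: inside `Γ'`, and applied to the vector `Γ u v`.
  have e6 : Γ' (fderiv ℝ f z u) (fderiv ℝ f z (γ z v)) = r • Γ' (fderiv ℝ f z u) (fderiv ℝ f z v)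
      + s • Γ' (fderiv ℝ f z u) (κ (f z) (fderiv ℝ f z v)) :=
    (congrArg (Γ' (fderiv ℝ f z u)) (e0 v)).trans (by rw [map_add, map_smul, map_smul])
  have e7 : fderiv ℝ f z (γ z (Γ u v)) = r • fderiv ℝ f z (Γ u v)
      + s • κ (f z) (fderiv ℝ f z (Γ u v)) := e0 (Γ u v)
  change fderiv ℝ (fderiv ℝ f) z u (γ z v) + Γ' (fderiv ℝ f z u) (fderiv ℝ f z (γ z v))
      - fderiv ℝ f z (Γ u (γ z v)) =
    r • (fderiv ℝ (fderiv ℝ f) z u v + Γ' (fderiv ℝ f z u) (fderiv ℝ f z v)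
      - fderiv ℝ f z (Γ u v))
    + s • κ (f z) (fderiv ℝ (fderiv ℝ f) z u v + Γ' (fderiv ℝ f z u) (fderiv ℝ f z v)
      - fderiv ℝ f z (Γ u v))
    + s • (fderiv ℝ κ (f z) (fderiv ℝ f z u) (fderiv ℝ f z v)
      + Γ' (fderiv ℝ f z u) (κ (f z) (fderiv ℝ f z v))
      - κ (f z) (Γ' (fderiv ℝ f z u) (fderiv ℝ f z v)))
    - fderiv ℝ f z (fderiv ℝ γ z u v + Γ u (γ z v) - γ z (Γ u v))
  rw [e5, e6, map_sub (κ (f z)), map_add (κ (f z)), map_sub (fderiv ℝ f z),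
    map_add (fderiv ℝ f z), e7]
  module

end GoldenMaps

/-! ### Vidal eigendistributions and the diagonal of `∇G` -/

section Vidal

variable {E : Type*} [NormedAddCommGroup E] [NormedSpace ℝ E] [FiniteDimensional ℝ E]
  {M : Type*} [TopologicalSpace M] [T2Space M] [ChartedSpace E M] [IsManifold 𝓘(ℝ, E) ∞ M]

omit [FiniteDimensional ℝ E] [T2Space M] in
theorem contMDiffOn_coordExt (x : M) (v : TangentSpace 𝓘(ℝ, E) x) :
    ContMDiffOn 𝓘(ℝ, E) (𝓘(ℝ, E).prod 𝓘(ℝ, E)) ∞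
      (fun y ↦ TotalSpace.mk' E (E := (TangentSpace 𝓘(ℝ, E) : M → Type _)) y (coordExt x v y))
      (chartAt E x).source := by
  let e := trivializationAt E (TangentSpace 𝓘(ℝ, E) : M → Type _) x
  refine (e.contMDiffOn_iff fun y hy ↦ e.mem_source.2 hy).2 ⟨contMDiffOn_id, ?_⟩
  refine (contMDiffOn_const (c := coordAt x x v)).congr fun y hy ↦ ?_
  refine Eq.trans ?_ (coordAt_frameAt hy (coordAt x x v))
  unfold coordAt
  rw [Trivialization.continuousLinearMapAt_apply]
  exact (congrFun (Trivialization.coe_linearMapAt_of_mem (R := ℝ) e hy) _).symm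

/-- Every tangent vector extends to a global smooth vector field. -/
theorem exists_smooth_extension (x : M) (v : TangentSpace 𝓘(ℝ, E) x) :
    ∃ X : ∀ y : M, TangentSpace 𝓘(ℝ, E) y,
      ContMDiff 𝓘(ℝ, E) (𝓘(ℝ, E).prod 𝓘(ℝ, E)) ∞
        (fun y ↦ TotalSpace.mk' E (E := (TangentSpace 𝓘(ℝ, E) : M → Type _)) y (X y)) ∧
      X x = v := by
  obtain ⟨φ⟩ : Nonempty (SmoothBumpFunction 𝓘(ℝ, E) x) := inferInstance
  -- The bump function is supported inside the chart domain, so the values of `coordExt` elsewhere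
  -- are irrelevant.
  refine ⟨fun y ↦ φ y • coordExt x v y, ?_, ?_⟩
  · exact φ.contMDiff.contMDiffOn.smul_section_of_tsupport (chartAt E x).open_source
      φ.tsupport_subset_chartAt_source (contMDiffOn_coordExt x v)
  · change φ x • coordExt x v x = v
    rw [φ.eq_one, one_smul, coordExt_self]

/-- The covariant derivative of `G` vanishes on the diagonal of a Vidal eigendistribution. -/
theorem covDerivEnd_self_of_isVidal (h : NondegMetric E M) (G : AlmostGolden E M) {k : ℝ}
    (hk : k * k = k + 1) (hV : h.IsVidal (G.eigendistribution k)) {x : M}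
    {w : TangentSpace 𝓘(ℝ, E) x} (hw : w ∈ G.eigendistribution k x) :
    h.covDerivEnd G.val x w w = 0 := by
  -- Vidality quantifies over global sections, so `w` must extend to one inside the
  -- eigendistribution. The operator `G + (k - 1) I` maps into the `k`-eigenspace and is
  -- multiplication by `2k - 1` on it; the factor `(2k - 1)⁻¹` compensates.
  obtain ⟨V, hVs, hVx⟩ := exists_smooth_extension x ((2 * k - 1)⁻¹ • w)
  have hk' : 2 * k - 1 ≠ 0 := by
    intro h0
    nlinarith
  have hw' : G.val x w = k • w := Module.End.mem_eigenspace_iff.1 hw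
  let X : ∀ y : M, TangentSpace 𝓘(ℝ, E) y := fun y ↦ G.val y (V y) + (k - 1) • V y
  have hX : ContMDiff 𝓘(ℝ, E) (𝓘(ℝ, E).prod 𝓘(ℝ, E)) ∞
      (fun y ↦ TotalSpace.mk' E (E := (TangentSpace 𝓘(ℝ, E) : M → Type _)) y (X y)) :=
    (G.contMDiff.clm_bundle_apply hVs).add_section hVs.const_smul_section
  have hXk : ∀ y, G.val y (X y) = k • X y := by
    intro y
    simp only [X, map_add, map_smul, G.sq]
    have : (1 : ℝ) = k * (k - 1) := by linarith
    rw [smul_add, smul_smul, ← this]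
    module
  have hXx : X x = w := by
    simp only [X, hVx, map_smul, hw', smul_smul, ← add_smul]
    rw [show (2 * k - 1)⁻¹ * k + (k - 1) * (2 * k - 1)⁻¹ = 1 by field_simp; ring, one_smul]
  have hmem := hV X hX (fun y ↦ Module.End.mem_eigenspace_iff.2 (hXk y)) x
  have hmem' : G.val x (h.covDeriv X x (X x)) = k • h.covDeriv X x (X x) :=
    Module.End.mem_eigenspace_iff.1 hmem
  rw [hXx, h.covDeriv_eq, hXx] at hmem'
  rw [h.covDerivEnd_eq]
  have hξ := (contDiffAt_fieldInChart (hX x)).differentiableAt (by simp)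
  have hγ := (G.contDiffAt_inChart x).differentiableAt (by simp)
  rw [← endInChart_self G.val x] at hmem' hw'
  have hev : (fun z ↦ endInChart G.val x z (fieldInChart X x z)) =ᶠ[𝓝 (extChartAt 𝓘(ℝ, E) x x)]
      fun z ↦ k • fieldInChart X x z := by
    filter_upwards [eventually_symm_mem_source x] with z hz
    set y := (extChartAt 𝓘(ℝ, E) x).symm z with hy
    change coordAt x y (G.val y (frameAt x y (coordAt x y (X y)))) = k • coordAt x y (X y)
    rw [frameAt_coordAt hz, hXk, map_smul]
  have hξx : fieldInChart X x (extChartAt 𝓘(ℝ, E) x x) = w := (fieldInChart_self X x).trans hXx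
  -- With `GX = kX`, the product rule gives `(∇_X G) X = k ∇_X X - G (∇_X X)`, which is zero because
  -- `∇_X X` is an eigenvector or zero. The rest is this computation in coordinates.
  set z := extChartAt 𝓘(ℝ, E) x x
  set γ := endInChart G.val x
  set ξ := fieldInChart X x
  set Γ := h.christoffelₗ x
  have key : fderiv ℝ (fun z ↦ γ z (ξ z)) z w = fderiv ℝ (fun z ↦ k • ξ z) z w := by
    rw [hev.fderiv_eq]
  have e1 : fderiv ℝ (fun z ↦ γ z (ξ z)) z w = γ z (fderiv ℝ ξ z w) + fderiv ℝ γ z w w := by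
    rw [fderiv_clm_apply hγ hξ]
    exact congrArg (fun t ↦ γ z (fderiv ℝ ξ z w) + fderiv ℝ γ z w t) hξx
  have e2 : fderiv ℝ (fun z ↦ k • ξ z) z w = k • fderiv ℝ ξ z w := by
    rw [fderiv_fun_const_smul hξ]
    rfl
  rw [e1, e2] at key
  have e3 : fderiv ℝ γ z w w = k • fderiv ℝ ξ z w - γ z (fderiv ℝ ξ z w) := by
    rw [← key]; abel
  have e4 : Γ w (γ z w) = k • Γ w w := (congrArg (Γ w) hw').trans ((Γ w).map_smul k w)
  have e5 : γ z (fderiv ℝ ξ z w) + γ z (Γ w w) = k • (fderiv ℝ ξ z w + Γ w w) :=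
    ((γ z).map_add _ _).symm.trans hmem'
  change fderiv ℝ γ z w w + Γ w (γ z w) - γ z (Γ w w) = (0 : E)
  rw [e3, e4, sub_add_eq_add_sub, sub_sub, e5, smul_add, sub_self]

end Vidal

/-! ### Metric traces over subspaces -/

section Trace

variable {E : Type*} [NormedAddCommGroup E] [NormedSpace ℝ E] [FiniteDimensional ℝ E]
  {M : Type*} [TopologicalSpace M] [ChartedSpace E M] [IsManifold 𝓘(ℝ, E) ∞ M]
  {W : Type*} [AddCommGroup W] [Module ℝ W]

/-- The basis of `D` dual to the chosen one, with respect to `h`. -/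
def NondegMetric.dualBasis (h : NondegMetric E M) (x : M)
    (D : Submodule ℝ (TangentSpace 𝓘(ℝ, E) x)) (i : Fin (Module.finrank ℝ D)) :
    TangentSpace 𝓘(ℝ, E) x :=
  ∑ j, (Matrix.of fun i j ↦ h.val x (Module.finBasis ℝ D i) (Module.finBasis ℝ D j))⁻¹ i j •
    (Module.finBasis ℝ D j : TangentSpace 𝓘(ℝ, E) x)

theorem NondegMetric.traceOn_eq_sum_dualBasis (h : NondegMetric E M) (x : M)
    (D : Submodule ℝ (TangentSpace 𝓘(ℝ, E) x))
    (T : TangentSpace 𝓘(ℝ, E) x →ₗ[ℝ] TangentSpace 𝓘(ℝ, E) x →ₗ[ℝ] W) :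
    h.traceOn x D (fun u v ↦ T u v) = ∑ i, T (Module.finBasis ℝ D i) (h.dualBasis x D i) := by
  simp only [traceOn, dualBasis, map_sum, map_smul]

/-- A kernel vector of the Gram matrix would be a nonzero `v ∈ D` orthogonal to `D`, hence with
`h(v, v) = 0`. Positivity is essential: a nondegenerate metric may degenerate on a subspace. -/
theorem NondegMetric.IsRiemannian.isUnit_det_gram {h : NondegMetric E M} (hR : h.IsRiemannian)
    (x : M) (D : Submodule ℝ (TangentSpace 𝓘(ℝ, E) x)) :
    IsUnit (Matrix.of fun i j ↦
      h.val x (Module.finBasis ℝ D i) (Module.finBasis ℝ D j)).det := by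
  set e := Module.finBasis ℝ D
  rw [isUnit_iff_ne_zero]
  intro hdet
  obtain ⟨c, hc, hHc⟩ := Matrix.exists_mulVec_eq_zero_iff.2 hdet
  set v : D := ∑ j, c j • e j with hv
  have hv0 : (v : TangentSpace 𝓘(ℝ, E) x) ≠ 0 := by
    intro h0
    refine hc (funext fun i ↦ ?_)
    have h1 : v = 0 := Subtype.ext h0
    exact Fintype.linearIndependent_iff.1 e.linearIndependent c (hv ▸ h1) i
  have hcoe : (v : TangentSpace 𝓘(ℝ, E) x) = ∑ j, c j • (e j : TangentSpace 𝓘(ℝ, E) x) := by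
    simp [hv]
  have hzero : ∀ i, h.val x (e i) v = 0 := by
    intro i
    have := congrFun hHc i
    rw [hcoe, map_sum]
    simpa [Matrix.mulVec, dotProduct, mul_comm] using this
  refine (hR x v hv0).ne' ?_
  conv_lhs => enter [1]; rw [hcoe]
  rw [map_sum, sum_apply]
  refine Finset.sum_eq_zero fun i _ ↦ ?_
  rw [map_smul, smul_apply, hzero, smul_zero]

theorem NondegMetric.IsRiemannian.sum_smul_dualBasis {h : NondegMetric E M}
    (hR : h.IsRiemannian) {x : M} {D : Submodule ℝ (TangentSpace 𝓘(ℝ, E) x)}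
    {v : TangentSpace 𝓘(ℝ, E) x} (hv : v ∈ D) :
    ∑ i, h.val x v (Module.finBasis ℝ D i) • h.dualBasis x D i = v := by
  have hu := hR.isUnit_det_gram x D
  set e := Module.finBasis ℝ D with he
  set H := Matrix.of fun i j ↦ h.val x (e i) (e j) with hH
  set c := e.repr ⟨v, hv⟩
  have hcoe : v = ∑ k, c k • (e k : TangentSpace 𝓘(ℝ, E) x) := by
    have := congrArg (Subtype.val) (e.sum_repr ⟨v, hv⟩)
    simp only [Submodule.coe_sum, Submodule.coe_smul] at this
    exact this.symm
  have h1 : ∀ i, h.val x v (e i) = Matrix.vecMul c H i := by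
    intro i
    conv_lhs => rw [hcoe]
    rw [map_sum, sum_apply]
    simp [Matrix.vecMul, dotProduct, hH]
  have h2 : ∀ i, h.dualBasis x D i = ∑ j, H⁻¹ i j • (e j : TangentSpace 𝓘(ℝ, E) x) := fun i ↦ rfl
  simp only [h1, h2, Finset.smul_sum, smul_smul]
  rw [Finset.sum_comm]
  simp only [← Finset.sum_smul]
  have h3 : ∀ j, ∑ i, Matrix.vecMul c H i * H⁻¹ i j = c j := by
    intro j
    have : Matrix.vecMul (Matrix.vecMul c H) H⁻¹ j = c j := by
      rw [Matrix.vecMul_vecMul, Matrix.mul_nonsing_inv _ hu, Matrix.vecMul_one]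
    exact this
  simp only [h3]
  exact hcoe.symm

theorem NondegMetric.gram_inv_symm (h : NondegMetric E M) (x : M)
    (D : Submodule ℝ (TangentSpace 𝓘(ℝ, E) x)) (i j : Fin (Module.finrank ℝ D)) :
    (Matrix.of fun i j ↦ h.val x (Module.finBasis ℝ D i) (Module.finBasis ℝ D j))⁻¹ i j =
    (Matrix.of fun i j ↦ h.val x (Module.finBasis ℝ D i) (Module.finBasis ℝ D j))⁻¹ j i := by
  set H := Matrix.of fun i j ↦ h.val x (Module.finBasis ℝ D i) (Module.finBasis ℝ D j) with hH
  have hT : H.transpose = H := by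
    ext i j
    simp [hH, Matrix.transpose_apply, h.symm x (Module.finBasis ℝ D j)]
  calc H⁻¹ i j = H.transpose⁻¹ i j := by rw [hT]
    _ = H⁻¹ j i := by rw [← Matrix.transpose_nonsing_inv, Matrix.transpose_apply]

theorem NondegMetric.IsRiemannian.sum_dualBasis_smul {h : NondegMetric E M}
    (hR : h.IsRiemannian) {x : M} {D : Submodule ℝ (TangentSpace 𝓘(ℝ, E) x)}
    {v : TangentSpace 𝓘(ℝ, E) x} (hv : v ∈ D) :
    ∑ i, h.val x v (h.dualBasis x D i) •
      (Module.finBasis ℝ D i : TangentSpace 𝓘(ℝ, E) x) = v := by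
  refine Eq.trans ?_ (hR.sum_smul_dualBasis hv)
  simp only [dualBasis, map_sum, map_smul, Finset.sum_smul, Finset.smul_sum, smul_smul,
    smul_eq_mul]
  rw [Finset.sum_comm]
  refine Finset.sum_congr rfl fun i _ ↦ Finset.sum_congr rfl fun j _ ↦ ?_
  rw [h.gram_inv_symm x D, mul_comm]

/-- The trace splits along an orthogonal decomposition of the tangent space. -/
theorem NondegMetric.IsRiemannian.traceOn_top {h : NondegMetric E M} (hR : h.IsRiemannian)
    {x : M} {D D' : Submodule ℝ (TangentSpace 𝓘(ℝ, E) x)} (hsup : D ⊔ D' = ⊤)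
    (horth : ∀ v ∈ D, ∀ w ∈ D', h.val x v w = 0)
    (T : TangentSpace 𝓘(ℝ, E) x →ₗ[ℝ] TangentSpace 𝓘(ℝ, E) x →ₗ[ℝ] W) :
    h.traceOn x ⊤ (fun u v ↦ T u v) =
      h.traceOn x D (fun u v ↦ T u v) + h.traceOn x D' (fun u v ↦ T u v) := by
  simp only [traceOn_eq_sum_dualBasis]
  -- Adding the reproducing formulas of `D` and `D'` reproduces every vector, since orthogonality
  -- kills the cross terms.
  have hdec : ∀ v : TangentSpace 𝓘(ℝ, E) x,
      ∑ j, h.val x v (Module.finBasis ℝ D j) • h.dualBasis x D j +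
        ∑ j, h.val x v (Module.finBasis ℝ D' j) • h.dualBasis x D' j = v := by
    intro v
    obtain ⟨a, ha, b, hb, rfl⟩ := Submodule.mem_sup.1 (hsup ▸ Submodule.mem_top : v ∈ D ⊔ D')
    have h1 : ∀ j, h.val x (a + b) (Module.finBasis ℝ D j) = h.val x a (Module.finBasis ℝ D j) := by
      intro j
      rw [map_add, add_apply, h.symm x b, horth _ (Subtype.mem _) _ hb, add_zero]
    have h2 : ∀ j, h.val x (a + b) (Module.finBasis ℝ D' j) =
        h.val x b (Module.finBasis ℝ D' j) := by
      intro j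
      rw [map_add, add_apply, horth _ ha _ (Subtype.mem _), zero_add]
    simp only [h1, h2]
    rw [hR.sum_smul_dualBasis ha, hR.sum_smul_dualBasis hb]
  -- Resummation over `i`: the coefficients `h(e^i, f_j)` are those of `f_j` in the basis `(e_i)` of
  -- the whole space.
  have hexp : ∀ (D₁ : Submodule ℝ (TangentSpace 𝓘(ℝ, E) x)),
      ∑ i, ∑ j, h.val x (h.dualBasis x ⊤ i) (Module.finBasis ℝ D₁ j) •
        T (Module.finBasis ℝ (⊤ : Submodule ℝ (TangentSpace 𝓘(ℝ, E) x)) i) (h.dualBasis x D₁ j) =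
      ∑ j, T (Module.finBasis ℝ D₁ j) (h.dualBasis x D₁ j) := by
    intro D₁
    rw [Finset.sum_comm]
    refine Finset.sum_congr rfl fun j _ ↦ ?_
    conv_rhs => rw [← hR.sum_dualBasis_smul (D := ⊤)
      (Submodule.mem_top (x := (Module.finBasis ℝ D₁ j : TangentSpace 𝓘(ℝ, E) x)))]
    rw [map_sum, LinearMap.sum_apply]
    refine Finset.sum_congr rfl fun i _ ↦ ?_
    rw [map_smul, LinearMap.smul_apply, h.symm]
  rw [← hexp D, ← hexp D', ← Finset.sum_add_distrib]
  refine Finset.sum_congr rfl fun i _ ↦ ?_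
  conv_lhs => rw [← hdec (h.dualBasis x ⊤ i)]
  simp only [map_add, map_sum, map_smul]

/-- The trace of a form that vanishes on the diagonal of `D` is zero. -/
theorem NondegMetric.traceOn_eq_zero_of_alternating (h : NondegMetric E M)
    {x : M} {D : Submodule ℝ (TangentSpace 𝓘(ℝ, E) x)}
    (T : TangentSpace 𝓘(ℝ, E) x →ₗ[ℝ] TangentSpace 𝓘(ℝ, E) x →ₗ[ℝ] W)
    (hT : ∀ v ∈ D, T v v = 0) : h.traceOn x D (fun u v ↦ T u v) = 0 := by
  have hneg : ∀ i j, T (Module.finBasis ℝ D i) (Module.finBasis ℝ D j) =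
      -T (Module.finBasis ℝ D j) (Module.finBasis ℝ D i) := by
    intro i j
    have h1 := hT _ (D.add_mem (Module.finBasis ℝ D i).2 (Module.finBasis ℝ D j).2)
    simp only [map_add, LinearMap.add_apply, hT _ (Subtype.mem _), zero_add, add_zero] at h1
    rw [add_comm] at h1
    exact eq_neg_of_add_eq_zero_left h1
  -- Exchanging the indices fixes the inverse Gram matrix and changes the sign of `T`.
  have hS : h.traceOn x D (fun u v ↦ T u v) = -h.traceOn x D (fun u v ↦ T u v) := by
    conv_lhs => simp only [traceOn]
    rw [Finset.sum_comm]
    simp only [traceOn, ← Finset.sum_neg_distrib]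
    refine Finset.sum_congr rfl fun i _ ↦ Finset.sum_congr rfl fun j _ ↦ ?_
    rw [hneg, smul_neg, h.gram_inv_symm x D]
  have h2 : (2 : ℝ) • h.traceOn x D (fun u v ↦ T u v) = 0 := by
    rw [two_smul]
    nth_rw 1 [hS]
    exact neg_add_cancel _
  exact (smul_eq_zero.1 h2).resolve_left two_ne_zero

/-- Congruence for the trace on `D`. -/
theorem NondegMetric.traceOn_congr (h : NondegMetric E M) {x : M}
    {D : Submodule ℝ (TangentSpace 𝓘(ℝ, E) x)}
    {S T : TangentSpace 𝓘(ℝ, E) x → TangentSpace 𝓘(ℝ, E) x → W}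
    (hST : ∀ u ∈ D, ∀ v ∈ D, S u v = T u v) : h.traceOn x D S = h.traceOn x D T := by
  refine Finset.sum_congr rfl fun i _ ↦ Finset.sum_congr rfl fun j _ ↦ ?_
  rw [hST _ (Subtype.mem _) _ (Subtype.mem _)]

theorem NondegMetric.traceOn_add (h : NondegMetric E M) {x : M}
    (D : Submodule ℝ (TangentSpace 𝓘(ℝ, E) x))
    (S T : TangentSpace 𝓘(ℝ, E) x → TangentSpace 𝓘(ℝ, E) x → W) :
    h.traceOn x D (fun u v ↦ S u v + T u v) = h.traceOn x D S + h.traceOn x D T := by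
  simp only [traceOn, smul_add, Finset.sum_add_distrib]

theorem NondegMetric.map_traceOn (h : NondegMetric E M) {x : M}
    (D : Submodule ℝ (TangentSpace 𝓘(ℝ, E) x)) {W' : Type*} [AddCommGroup W'] [Module ℝ W']
    (A : W →ₗ[ℝ] W') (T : TangentSpace 𝓘(ℝ, E) x → TangentSpace 𝓘(ℝ, E) x → W) :
    h.traceOn x D (fun u v ↦ A (T u v)) = A (h.traceOn x D T) := by
  simp only [traceOn, map_sum, map_smul]

end Trace

/-! ### The orthogonal splitting into eigendistributions -/

section Splitting

variable {E : Type*} [NormedAddCommGroup E] [NormedSpace ℝ E]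
  {M : Type*} [TopologicalSpace M] [ChartedSpace E M] [IsManifold 𝓘(ℝ, E) ∞ M]

/-- The eigenprojections are `(G - σ̄ I)/√5` and `-(G - σ I)/√5`; they sum to `I` because `σ - σ̄ =
√5`. -/
theorem AlmostGolden.eigendistribution_sup (G : AlmostGolden E M) (x : M) :
    G.eigendistribution Real.goldenRatio x ⊔ G.eigendistribution Real.goldenConj x = ⊤ := by
  refine eq_top_iff.2 fun v _ ↦ Submodule.mem_sup.2 ?_
  have h5 : (√5 : ℝ) ≠ 0 := by positivity
  have hσ := Real.goldenRatio_sub_goldenConj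
  have hp := Real.goldenRatio_mul_goldenConj
  have hs := Real.goldenRatio_add_goldenConj
  refine ⟨(√5)⁻¹ • (G.val x v - Real.goldenConj • v), Module.End.mem_eigenspace_iff.2 ?_,
    (-(√5)⁻¹) • (G.val x v - Real.goldenRatio • v), Module.End.mem_eigenspace_iff.2 ?_, ?_⟩
  · change G.val x _ = _
    rw [map_smul, map_sub, map_smul, G.sq, smul_comm Real.goldenRatio]
    congr 1
    rw [smul_sub, smul_smul, hp, eq_sub_of_add_eq hs]
    module
  · change G.val x _ = _
    rw [map_smul, map_sub, map_smul, G.sq, smul_comm Real.goldenConj]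
    congr 1
    rw [smul_sub, smul_smul, mul_comm, hp, eq_sub_of_add_eq' hs]
    module
  · rw [neg_smul, ← sub_eq_add_neg, ← smul_sub, sub_sub_sub_cancel_left, ← sub_smul, hσ,
      inv_smul_smul₀ h5]

theorem IsPure.eigendistribution_orthogonal {h : NondegMetric E M} {G : AlmostGolden E M}
    (hG : IsPure h G) {x : M} {k l : ℝ} (hkl : k ≠ l) {v w : TangentSpace 𝓘(ℝ, E) x}
    (hv : v ∈ G.eigendistribution k x) (hw : w ∈ G.eigendistribution l x) :
    h.val x v w = 0 := by
  have h1 := hG x v w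
  rw [show G.val x v = k • v from Module.End.mem_eigenspace_iff.1 hv,
    show G.val x w = l • w from Module.End.mem_eigenspace_iff.1 hw, map_smul, map_smul,
    smul_apply, smul_eq_mul, smul_eq_mul, ← sub_eq_zero, ← sub_mul] at h1
  exact (mul_eq_zero.1 h1).resolve_left (sub_ne_zero.2 hkl)

/-- The trace splits along the eigendistributions of a golden structure with pure metric. -/
theorem IsAlmostGoldenRiemannian.traceOn_top [FiniteDimensional ℝ E] {h : NondegMetric E M}
    {G : AlmostGolden E M} (hG : IsAlmostGoldenRiemannian h G) {x : M}
    {W : Type*} [AddCommGroup W] [Module ℝ W]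
    (T : TangentSpace 𝓘(ℝ, E) x →ₗ[ℝ] TangentSpace 𝓘(ℝ, E) x →ₗ[ℝ] W) :
    h.traceOn x ⊤ (fun u v ↦ T u v) =
      h.traceOn x (G.eigendistribution Real.goldenRatio x) (fun u v ↦ T u v) +
      h.traceOn x (G.eigendistribution Real.goldenConj x) (fun u v ↦ T u v) :=
  hG.1.traceOn_top (G.eigendistribution_sup x) (fun _ hv _ hw ↦
    hG.2.eigendistribution_orthogonal
      (Real.goldenConj_neg.trans Real.goldenRatio_pos).ne' hv hw) T

/-- The trace splitting requires a bundled bilinear map, whereas `covDerivEnd` is a bare function.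
-/
theorem NondegMetric.exists_covDerivEnd_bilinear (h : NondegMetric E M) (G : AlmostGolden E M)
    (x : M) : ∃ T : TangentSpace 𝓘(ℝ, E) x →ₗ[ℝ] TangentSpace 𝓘(ℝ, E) x →ₗ[ℝ]
      TangentSpace 𝓘(ℝ, E) x, ∀ u v, h.covDerivEnd G.val x u v = T u v := by
  let γ : E →ₗ[ℝ] E := (endInChart G.val x (extChartAt 𝓘(ℝ, E) x x)).toLinearMap
  let T : E →ₗ[ℝ] E →ₗ[ℝ] E :=
    (fderiv ℝ (endInChart G.val x) (extChartAt 𝓘(ℝ, E) x x)).toLinearMap₁₂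
      + (h.christoffelₗ x).compl₂ γ - (h.christoffelₗ x).compr₂ γ
  exact ⟨T, fun u v ↦ h.covDerivEnd_eq G x u v⟩

end Splitting

/-! ### Eigen tension fields and the weighted trace identity -/

section Maps

variable {E : Type*} [NormedAddCommGroup E] [NormedSpace ℝ E]
  {M : Type*} [TopologicalSpace M] [ChartedSpace E M] [IsManifold 𝓘(ℝ, E) ∞ M]
  {E' : Type*} [NormedAddCommGroup E'] [NormedSpace ℝ E']
  {N : Type*} [TopologicalSpace N] [ChartedSpace E' N] [IsManifold 𝓘(ℝ, E') ∞ N]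

theorem exists_secondFundamentalForm_bilinear (h : NondegMetric E M) (g : NondegMetric E' N)
    {F : M → N} (hF : ContMDiff 𝓘(ℝ, E) 𝓘(ℝ, E') ∞ F) (x : M) :
    ∃ T : TangentSpace 𝓘(ℝ, E) x →ₗ[ℝ] TangentSpace 𝓘(ℝ, E) x →ₗ[ℝ]
      TangentSpace 𝓘(ℝ, E') (F x), ∀ u v, secondFundamentalForm h g F x u v = T u v := by
  let L : E →ₗ[ℝ] E' := (fderiv ℝ (mapInChart E E' F x) (extChartAt 𝓘(ℝ, E) x x)).toLinearMap
  let T : E →ₗ[ℝ] E →ₗ[ℝ] E' :=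
    (fderiv ℝ (fderiv ℝ (mapInChart E E' F x)) (extChartAt 𝓘(ℝ, E) x x)).toLinearMap₁₂
      + (g.christoffelₗ (F x)).compl₁₂ L L - (h.christoffelₗ x).compr₂ L
  exact ⟨T, fun u v ↦ secondFundamentalForm_eq h g hF x u v⟩

variable [FiniteDimensional ℝ E]

theorem tensionField_top_eq_add {h : NondegMetric E M} {G : AlmostGolden E M}
    (hM : IsAlmostGoldenRiemannian h G) (g : NondegMetric E' N)
    {F : M → N} (hF : ContMDiff 𝓘(ℝ, E) 𝓘(ℝ, E') ∞ F) (x : M) :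
    tensionField h g (fun _ ↦ ⊤) F x =
      tensionField h g (G.eigendistribution Real.goldenRatio) F x +
      tensionField h g (G.eigendistribution Real.goldenConj) F x := by
  obtain ⟨T, hT⟩ := exists_secondFundamentalForm_bilinear h g hF x
  have hT' : secondFundamentalForm h g F x = fun u v ↦ T u v :=
    funext fun u ↦ funext fun v ↦ hT u v
  unfold tensionField
  rw [hT']
  exact hM.traceOn_top T

/-- The eigenvalue-weighted sum of the eigen tension fields of a map with
`F_* ∘ G = r F_* + s K ∘ F_*`, when `div G = 0` and `∇K` vanishes on the diagonal of the images of
the eigendistributions. -/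
theorem smul_tensionField_add_smul_tensionField {h : NondegMetric E M} {G : AlmostGolden E M}
    (hM : IsSemiDecomposableGoldenRiemannian h G) {g : NondegMetric E' N} {K : AlmostGolden E' N}
    {F : M → N} (hF : ContMDiff 𝓘(ℝ, E) 𝓘(ℝ, E') ∞ F) {r s : ℝ}
    (hGK : ∀ (x : M) (v : TangentSpace 𝓘(ℝ, E) x), mfderiv 𝓘(ℝ, E) 𝓘(ℝ, E') F x (G.val x v) =
      r • mfderiv 𝓘(ℝ, E) 𝓘(ℝ, E') F x v + s • K.val (F x) (mfderiv 𝓘(ℝ, E) 𝓘(ℝ, E') F x v))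
    {x : M}
    (hplus : ∀ v ∈ G.eigendistribution Real.goldenRatio x, g.covDerivEnd K.val (F x)
      (mfderiv 𝓘(ℝ, E) 𝓘(ℝ, E') F x v) (mfderiv 𝓘(ℝ, E) 𝓘(ℝ, E') F x v) = 0)
    (hminus : ∀ v ∈ G.eigendistribution Real.goldenConj x, g.covDerivEnd K.val (F x)
      (mfderiv 𝓘(ℝ, E) 𝓘(ℝ, E') F x v) (mfderiv 𝓘(ℝ, E) 𝓘(ℝ, E') F x v) = 0) :
    Real.goldenRatio • tensionField h g (G.eigendistribution Real.goldenRatio) F x +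
      Real.goldenConj • tensionField h g (G.eigendistribution Real.goldenConj) F x =
    r • tensionField h g (fun _ ↦ ⊤) F x
      + s • K.val (F x) (tensionField h g (fun _ ↦ ⊤) F x) := by
  obtain ⟨T, hT⟩ := exists_secondFundamentalForm_bilinear h g hF x
  obtain ⟨Q, hQ⟩ := g.exists_covDerivEnd_bilinear K (F x)
  let L := (mfderiv 𝓘(ℝ, E) 𝓘(ℝ, E') F x).toLinearMap
  let A := (K.val (F x)).toLinearMap
  have hT' : secondFundamentalForm h g F x = fun u v ↦ T u v :=
    funext fun u ↦ funext fun v ↦ hT u v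
  have hR : h.traceOn x ⊤ (fun u v ↦ Q.compl₁₂ L L u v) = 0 := by
    rw [hM.1.traceOn_top, h.traceOn_eq_zero_of_alternating, h.traceOn_eq_zero_of_alternating,
      add_zero]
    · exact fun v hv ↦ (hQ _ _).symm.trans (hminus v hv)
    · exact fun v hv ↦ (hQ _ _).symm.trans (hplus v hv)
  have heig : ∀ k, h.traceOn x (G.eigendistribution k x)
      (fun u v ↦ T.compl₂ (G.val x).toLinearMap u v) =
        k • h.traceOn x (G.eigendistribution k x) (fun u v ↦ T u v) := by
    intro k
    refine Eq.trans ?_ (h.map_traceOn _ (LinearMap.lsmul ℝ _ k) _)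
    refine h.traceOn_congr fun u _ v hv ↦ ?_
    change T u (G.val x v) = k • T u v
    rw [show G.val x v = k • v from Module.End.mem_eigenspace_iff.1 hv, map_smul]
  -- Every term on the right is a fixed linear map applied to a form, so that `map_traceOn` can pull
  -- it out of the trace.
  have htot : h.traceOn x ⊤ (fun u v ↦ T.compl₂ (G.val x).toLinearMap u v) =
      h.traceOn x ⊤ (fun u v ↦ (r • LinearMap.id + s • A : _ →ₗ[ℝ] _) (T u v)) +
        (h.traceOn x ⊤ (fun u v ↦ (s • LinearMap.id : _ →ₗ[ℝ] _) (Q.compl₁₂ L L u v)) +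
          h.traceOn x ⊤ (fun u v ↦ (-L) (h.covDerivEnd G.val x u v))) := by
    rw [← h.traceOn_add, ← h.traceOn_add]
    refine h.traceOn_congr fun u _ v _ ↦ ?_
    have := secondFundamentalForm_golden h g G K hF hGK x u v
    rw [hT, hT, hQ] at this
    refine this.trans ?_
    rw [sub_eq_add_neg, add_assoc]
    rfl
  have hdiv : h.traceOn x ⊤ (h.covDerivEnd G.val x) = 0 := hM.2 x
  rw [h.map_traceOn, h.map_traceOn, h.map_traceOn, hR, hdiv, map_zero, map_zero, add_zero,
    add_zero, hM.1.traceOn_top, heig, heig] at htot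
  unfold tensionField
  rw [hT']
  exact htot

end Maps

end GoldenGeometry

end

/-! ### The equivalence -/

theorem mainTheorem4
    {E : Type*} [NormedAddCommGroup E] [NormedSpace ℝ E] [FiniteDimensional ℝ E]
    {E' : Type*} [NormedAddCommGroup E'] [NormedSpace ℝ E'] [FiniteDimensional ℝ E']
    {M : Type*} [TopologicalSpace M] [T2Space M] [ChartedSpace E M] [IsManifold 𝓘(ℝ, E) ∞ M]
    {N : Type*} [TopologicalSpace N] [T2Space N] [ChartedSpace E' N] [IsManifold 𝓘(ℝ, E') ∞ N]
    (h : GoldenGeometry.NondegMetric E M) (G : GoldenGeometry.AlmostGolden E M)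
    (g : GoldenGeometry.NondegMetric E' N) (K : GoldenGeometry.AlmostGolden E' N)
    (hM : GoldenGeometry.IsSemiDecomposableGoldenRiemannian h G)
    (hN : GoldenGeometry.IsAlmostGoldenRiemannian g K ∨
      GoldenGeometry.IsAlmostGoldenHermitian g K)
    (hVplus : g.IsVidal (K.eigendistribution Real.goldenRatio))
    (hVminus : g.IsVidal (K.eigendistribution Real.goldenConj))
    (F : M → N) (hF : ContMDiff 𝓘(ℝ, E) 𝓘(ℝ, E') ∞ F)
    (hGK : GoldenGeometry.IsGoldenMap G K F ∨ GoldenGeometry.IsAntigoldenMap G K F) :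
    GoldenGeometry.IsHarmonic h g F ↔
      (GoldenGeometry.IsPlusEigenHarmonic h G g F ∧
        GoldenGeometry.IsMinusEigenHarmonic h G g F) := by
  have hadd := GoldenGeometry.tensionField_top_eq_add hM.1 g hF
  refine ⟨fun hH ↦ ?_, fun hpm x ↦ by rw [hadd, hpm.1 x, hpm.2 x, add_zero]⟩
  have hp : ∀ {y : N} {w : TangentSpace 𝓘(ℝ, E') y}, K.val y w = Real.goldenRatio • w →
      g.covDerivEnd K.val y w w = 0 := fun hw ↦
    GoldenGeometry.covDerivEnd_self_of_isVidal g K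
      (by rw [← sq, Real.goldenRatio_sq]) hVplus (Module.End.mem_eigenspace_iff.2 hw)
  have hm : ∀ {y : N} {w : TangentSpace 𝓘(ℝ, E') y}, K.val y w = Real.goldenConj • w →
      g.covDerivEnd K.val y w w = 0 := fun hw ↦
    GoldenGeometry.covDerivEnd_self_of_isVidal g K
      (by rw [← sq, Real.goldenConj_sq]) hVminus (Module.End.mem_eigenspace_iff.2 hw)
  have hweighted : ∀ x,
      Real.goldenRatio • GoldenGeometry.tensionField h g
          (G.eigendistribution Real.goldenRatio) F x +
        Real.goldenConj • GoldenGeometry.tensionField h g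
          (G.eigendistribution Real.goldenConj) F x = 0 := by
    intro x
    rcases hGK with hGK | hGK
    · have key : ∀ {k : ℝ} {v : TangentSpace 𝓘(ℝ, E) x}, v ∈ G.eigendistribution k x →
          K.val (F x) (mfderiv 𝓘(ℝ, E) 𝓘(ℝ, E') F x v) =
            k • mfderiv 𝓘(ℝ, E) 𝓘(ℝ, E') F x v := by
        intro k v hv
        rw [← hGK, ← map_smul, show G.val x v = k • v from Module.End.mem_eigenspace_iff.1 hv]
      have hT : GoldenGeometry.tensionField h g (fun _ ↦ ⊤) F x = 0 := hH x
      rw [GoldenGeometry.smul_tensionField_add_smul_tensionField hM (K := K) hF (r := 0) (s := 1)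
        (fun x v ↦ by rw [hGK]; module) (fun v hv ↦ hp (key hv)) (fun v hv ↦ hm (key hv)), hT,
        map_zero, smul_zero, smul_zero, add_zero]
    · have key : ∀ {k : ℝ} {v : TangentSpace 𝓘(ℝ, E) x}, v ∈ G.eigendistribution k x →
          K.val (F x) (mfderiv 𝓘(ℝ, E) 𝓘(ℝ, E') F x v) =
            (1 - k) • mfderiv 𝓘(ℝ, E) 𝓘(ℝ, E') F x v := by
        intro k v hv
        have h1 := hGK x v
        rw [show G.val x v = k • v from Module.End.mem_eigenspace_iff.1 hv, map_smul] at h1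
        rw [sub_smul, h1, one_smul]
        exact (sub_sub_cancel _ _).symm
      have hT : GoldenGeometry.tensionField h g (fun _ ↦ ⊤) F x = 0 := hH x
      -- The conjugate `I - K` gives `r = 1`, `s = -1`. As `1 - σ = σ̄`, `F_*` interchanges the
      -- eigenvalues, so the two Vidal conditions trade places.
      rw [GoldenGeometry.smul_tensionField_add_smul_tensionField hM (K := K) hF (r := 1) (s := -1)
        (fun x v ↦ by
          rw [hGK, one_smul, neg_one_smul, ← sub_eq_add_neg]
          rfl)
        (fun v hv ↦ hm (by rw [key hv, Real.one_sub_goldenConj]))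
        (fun v hv ↦ hp (by rw [key hv, Real.one_sub_goldenRatio])), hT,
        map_zero, smul_zero, smul_zero, add_zero]
  have hplus : ∀ x, GoldenGeometry.tensionField h g
      (G.eigendistribution Real.goldenRatio) F x = 0 := by
    intro x
    have h1 := hweighted x
    have h2 := (hadd x).symm.trans (hH x)
    -- Substituting `τ₋ = -τ₊` leaves `√5 τ₊ = 0`.
    rw [eq_neg_of_add_eq_zero_right h2, smul_neg, ← sub_eq_add_neg, ← sub_smul,
      Real.goldenRatio_sub_goldenConj] at h1
    exact (smul_eq_zero.1 h1).resolve_left (by positivity)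
  refine ⟨hplus, fun x ↦ ?_⟩
  have h2 := (hadd x).symm.trans (hH x)
  rwa [hplus x, zero_add] at h2
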